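/- Let $n\ge 1$ be an integer, let $p\in[1,\infty]$, and let $q$ be the conjugate exponent, $1/p+1/q=1$ (with $1/\infty=0$). Let $\mathcal P_n$ be the set of monic real polynomials of degree $n$. For $\varphi\in\mathcal P_n$ and $a<b$ put $\varphi_{a,b}(x)=\left(\frac{b-a}{2}\right)^n\varphi\!\left(\frac{2x-a-b}{b-a}\right)$, which is again in $\mathcal P_n$. For $f:[a,b]\to\mathbb R$ such that $f^{(n-1)}$ is absolutely continuous and $f^{(n)}\in L^p([a,b])$ let $$E_n(f)=\frac{(-1)^n}{n!}\int_a^b f^{(n)}(x)\,\varphi_{a,b}(x)\,dx .$$ Let $K_{n,p}(\varphi)$ be the smallest constant $K$ such that $$|E_n(f)|\le K\,\|f^{(n)}\|_{L^p([a,b])}\,(b-a)^{n+1/q}$$ for all $a<b$ and all such $f$, and let $\tilde K_{n,p}=\min_{\varphi\in\mathcal P_n}K_{n,p}(\varphi)$. Then the smallest constants and the minimum exist, and $\tilde K_{n,p}=K_{n,p}(\tilde\varphi)=2^{-n-1/q}\,\|\tilde\varphi\|_{L^q([-1,1])}/n!$ for some $\tilde\varphi\in\mathcal P_n$ at which the minimum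 is attained. Moreover $$\tilde K_{n,1}=\frac{2^{1-2n}}{n!},\qquad \tilde K_{n,2}=\frac{n!\,(2n+1)^{-1/2}}{(2n)!},\qquad \tilde K_{n,\infty}=\frac{2^{-2n}}{n!}.$$ For each fixed $n$, $\tilde K_{n,p}$ is a (strictly) decreasing function of $p\in[1,\infty]$, and so is $K_{n,p}(\varphi)$ for each fixed $\varphi\in\mathcal P_n$. Hence $\tilde K_{n,p}\le\tilde K_{n,1}$, and $K_{n,p}(\varphi)\le K_{n,1}(\varphi)$ for every $\varphi\in\mathcal P_n$. -/

import Mathlib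

open MeasureTheory Set Polynomial
open scoped ENNReal

noncomputable section

namespace Quadrature

/-- The real number `1/q`, where `q` is the conjugate exponent of `p ∈ [1, ∞]` (with `1/∞ = 0`). -/
def invConj (p : ℝ≥0∞) : ℝ := (ENNReal.conjExponent p)⁻¹.toReal

/-- The norm of `g` in `L^p([a,b])`, for Lebesgue measure (finite for `g ∈ L^p([a,b])`). -/
def lpNormOn (p : ℝ≥0∞) (a b : ℝ) (g : ℝ → ℝ) : ℝ :=
  (eLpNorm g p (volume.restrict (Icc a b))).toReal

/-- The `k`-th derivative of `f : [a,b] → ℝ` (one-sided at the end points). -/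
def derivOn (k : ℕ) (a b : ℝ) (f : ℝ → ℝ) : ℝ → ℝ :=
  iteratedDerivWithin k f (Icc a b)

/-- For `n ≥ 1`: `f^{(n-1)}` exists on `[a,b]` and is absolutely continuous there, and the
almost everywhere defined function `f^{(n)}` is in `L^p([a,b])`. -/
structure IsAdmissible (n : ℕ) (p : ℝ≥0∞) (a b : ℝ) (f : ℝ → ℝ) : Prop where
  contDiffOn : ContDiffOn ℝ ((n - 1 : ℕ) : ℕ∞) f (Icc a b)
  absolutelyContinuous : AbsolutelyContinuousOnInterval (derivOn (n - 1) a b f) a b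
  memLp : MemLp (derivOn n a b f) p (volume.restrict (Icc a b))

/-- The monic real polynomials of degree `n`. -/
def monicPolys (n : ℕ) : Set ℝ[X] := {φ | φ.Monic ∧ φ.natDegree = n}

/-- A monic polynomial of degree `n` on the reference interval `[-1,1]`, transplanted to `[a,b]`
by the increasing affine bijection and normalised so as to be monic again. -/
def transplant (n : ℕ) (φ : ℝ[X]) (a b : ℝ) (x : ℝ) : ℝ :=
  ((b - a) / 2) ^ n * φ.eval ((2 * x - a - b) / (b - a))

/-- The error term `E_n(f) = (-1)^n / n! ∫_a^b f^{(n)}(x) φ_n(x) dx`, where `φ_n` is the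
transplant of `φ` to `[a,b]`. -/
def errorTerm (n : ℕ) (φ : ℝ[X]) (a b : ℝ) (f : ℝ → ℝ) : ℝ :=
  (-1) ^ n / (n.factorial : ℝ) * ∫ x in a..b, derivOn n a b f x * transplant n φ a b x

/-- `C` is a constant, independent of `f` and of the interval, for which
`|E_n(f)| ≤ C ‖f^{(n)}‖_p (b-a)^{n+1/q}`. -/
def IsErrorConstant (n : ℕ) (p : ℝ≥0∞) (φ : ℝ[X]) (C : ℝ) : Prop :=
  ∀ a b : ℝ, a < b → ∀ f : ℝ → ℝ, IsAdmissible n p a b f →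
    |errorTerm n φ a b f| ≤
      C * lpNormOn p a b (derivOn n a b f) * (b - a) ^ ((n : ℝ) + invConj p)

/-- `K_{n,p}` for the polynomial `φ`: the smallest constant in the error estimate. -/
def errorConst (n : ℕ) (p : ℝ≥0∞) (φ : ℝ[X]) : ℝ :=
  sInf {C : ℝ | IsErrorConstant n p φ C}

/-- The optimal constant: the smallest value of `K_{n,p}` over the monic polynomials of
degree `n`. -/
def optimalConst (n : ℕ) (p : ℝ≥0∞) : ℝ :=
  sInf (errorConst n p '' monicPolys n)

end Quadrature

end

/-!
Rescaling `[a,b]` to `[-1,1]` and applying Hölder's inequality shows that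
`2 ^ (-n - 1/q) ‖φ‖_q / n!` is an error constant. It is the smallest one by duality: every
continuous function is an `n`-th derivative, and testing against functions `G ∘ φ` with `G`
continuous recovers `‖φ‖_q`. The optimal constant thus asks for the monic polynomial of least
norm, a best approximation problem in a finite-dimensional space; the solutions for `q = ∞, 2, 1`
are multiples of the Chebyshev polynomial of the first kind, the Legendre polynomial and the
Chebyshev polynomial of the second kind. For the last two, minimality follows from Hölder's
inequality, because the Legendre polynomial and the sign of `U_n` are orthogonal to all
polynomials of lower degree.

Finally `2 ^ (-1/q) ‖φ‖_q` is the norm for the uniform probability measure on `[-1,1]`, which is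
strictly increasing in `q` because `|φ|` is not constant, and `q` decreases as `p` increases.
-/

noncomputable section

namespace Quadrature

open scoped Topology

/-! ### `L^p` norms: duality and strict monotonicity in the exponent -/

section Lp

variable {α : Type*} {mα : MeasurableSpace α} {μ : Measure α}

lemma memLp_comp_of_memLp_top [IsFiniteMeasure μ] {h : α → ℝ} (hh : MemLp h ∞ μ) {G : ℝ → ℝ}
    (hG : Continuous G) (p : ℝ≥0∞) : MemLp (fun x => G (h x)) p μ := by
  set M := lpNorm h ∞ μ
  obtain ⟨B, hB⟩ := (isCompact_Icc (a := -M) (b := M)).exists_bound_of_continuousOn hG.continuousOn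
  refine MemLp.of_bound (hG.comp_aestronglyMeasurable hh.1) B ?_
  filter_upwards [ae_le_lpNorm_exponent_top hh] with x hx using hB _ (abs_le.1 hx)

lemma abs_integral_mul_le_lpNorm_mul_lpNorm {p q : ℝ≥0∞} [p.HolderConjugate q] {f g : α → ℝ}
    (hf : MemLp f p μ) (hg : MemLp g q μ) :
    |∫ x, f x * g x ∂μ| ≤ lpNorm f p μ * lpNorm g q μ := by
  have hHolder := ENNReal.toReal_mono (ENNReal.mul_ne_top hf.2.ne hg.2.ne)
    (eLpNorm_smul_le_mul_eLpNorm (p := p) (q := q) (r := 1) hg.1 hf.1)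
  rw [ENNReal.toReal_mul, toReal_eLpNorm hf.1, toReal_eLpNorm hg.1,
    toReal_eLpNorm (hf.1.smul hg.1), lpNorm_one_eq_integral_norm (hf.1.smul hg.1)] at hHolder
  exact (norm_integral_le_integral_norm _).trans hHolder

lemma lpNorm_top_le_of_ae_abs_le {h : α → ℝ} {C : ℝ} (hC : 0 ≤ C) (hh : AEStronglyMeasurable h μ)
    (hle : ∀ᵐ x ∂μ, |h x| ≤ C) : lpNorm h ∞ μ ≤ C := by
  rw [← toReal_eLpNorm hh, eLpNorm_exponent_top]
  exact ENNReal.toReal_le_of_le_ofReal hC (eLpNormEssSup_le_of_ae_bound hle)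

lemma lpNorm_rpow_toReal {q : ℝ≥0∞} (hq0 : q ≠ 0) (hq : q ≠ ∞) {h : α → ℝ}
    (hh : AEStronglyMeasurable h μ) : lpNorm h q μ ^ q.toReal = ∫ x, |h x| ^ q.toReal ∂μ := by
  rw [lpNorm_eq_integral_norm_rpow_toReal hq0 hq hh,
    Real.rpow_inv_rpow (integral_nonneg fun _ => by positivity) (ENNReal.toReal_pos hq0 hq).ne']
  rfl

lemma one_le_toReal_of_holderConjugate {p q : ℝ≥0∞} [q.HolderConjugate p] (hq : q ≠ ∞) :
    1 ≤ q.toReal :=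
  (ENNReal.ofReal_le_iff_le_toReal hq).1 (by simpa using ENNReal.HolderConjugate.one_le q p)

lemma lpNorm_abs_rpow_le {p q : ℝ≥0∞} [q.HolderConjugate p] (hq : q ≠ ∞) {h : α → ℝ}
    (hh : AEStronglyMeasurable h μ) :
    lpNorm (fun x => |h x| ^ (q.toReal - 1)) p μ ≤ lpNorm h q μ ^ (q.toReal - 1) := by
  have hmeas : AEStronglyMeasurable (fun x => |h x| ^ (q.toReal - 1)) μ :=
    (Real.continuous_rpow_const (sub_nonneg.2 (one_le_toReal_of_holderConjugate (p := p) hq))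
      |>.comp continuous_abs).comp_aestronglyMeasurable hh
  rw [← toReal_eLpNorm hmeas, ← toReal_eLpNorm hh]
  rcases (one_le_toReal_of_holderConjugate (p := p) hq).eq_or_lt with h1 | h1
  · obtain rfl : q = 1 := by rwa [← ENNReal.toReal_eq_one_iff, eq_comm]
    obtain rfl : p = ∞ := ENNReal.HolderConjugate.unique 1 p ∞
    refine ENNReal.toReal_le_of_le_ofReal (by positivity) ?_
    simpa using eLpNormEssSup_le_of_ae_bound (f := fun _ : α => (1 : ℝ)) (C := 1)
      (.of_forall fun _ => by simp)
  · have hconj : q.toReal.HolderConjugate p.toReal := ENNReal.HolderConjugate.toReal h1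
    have hp : p ≠ ∞ := fun hp => hconj.symm.ne_zero (by simp [hp])
    have hmul : p * ENNReal.ofReal (q.toReal - 1) = q := by
      rw [← ENNReal.ofReal_toReal hp, ← ENNReal.ofReal_mul hconj.symm.nonneg, mul_comm,
        hconj.sub_one_mul_conj, ENNReal.ofReal_toReal hq]
    have := eLpNorm_norm_rpow (p := p) (μ := μ) h (sub_pos.2 h1)
    rw [hmul] at this
    simp only [Real.norm_eq_abs] at this
    rw [this, ENNReal.toReal_rpow]

lemma exists_continuous_le_mul_self {s : ℝ} (hs : 1 ≤ s) {ε : ℝ} (hε : 0 < ε) :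
    ∃ G : ℝ → ℝ, Continuous G ∧ (∀ t, |G t| ≤ |t| ^ (s - 1)) ∧
      ∀ t, |t| ^ s - ε * |t| ^ (s - 1) ≤ G t * t := by
  have hpos (t : ℝ) : 0 < |t| + ε := by positivity
  -- The function `sign t * |t| ^ (s - 1)`, with the jump for `s = 1` smoothed away.
  refine ⟨fun t => t / (|t| + ε) * |t| ^ (s - 1), ?_, fun t => ?_, fun t => ?_⟩
  · exact (continuous_id.div (by fun_prop) fun t => (hpos t).ne').mul
      (continuous_abs.rpow_const fun _ => .inr (sub_nonneg.2 hs))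
  · rw [abs_mul, abs_of_nonneg (by positivity : 0 ≤ |t| ^ (s - 1)), abs_div, abs_of_pos (hpos t)]
    exact mul_le_of_le_one_left (by positivity) ((div_le_one (hpos t)).2 (by linarith))
  · have hsplit : |t| ^ s = |t| * |t| ^ (s - 1) := by
      rw [← Real.rpow_one_add' (abs_nonneg t) (by linarith), add_sub_cancel]
    have hquot : |t| - ε ≤ t / (|t| + ε) * t := by
      rw [div_mul_eq_mul_div, le_div_iff₀ (hpos t), ← abs_mul_abs_self t]
      nlinarith [sq_nonneg ε]
    rw [hsplit, ← sub_mul, mul_right_comm]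
    gcongr

section Duality

variable [IsFiniteMeasure μ] {p q : ℝ≥0∞} {h : α → ℝ} {D : ℝ}

lemma lpNorm_rpow_le_of_forall_abs_integral_comp_mul_le [q.HolderConjugate p] (hq : q ≠ ∞)
    (hh : MemLp h ∞ μ) (hD0 : 0 ≤ D)
    (hD : ∀ G : ℝ → ℝ, Continuous G →
      |∫ x, G (h x) * h x ∂μ| ≤ D * lpNorm (fun x => G (h x)) p μ) :
    lpNorm h q μ ^ q.toReal ≤ D * lpNorm h q μ ^ (q.toReal - 1) := by
  have hs := one_le_toReal_of_holderConjugate (p := p) hq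
  have hq0 : q ≠ 0 := ENNReal.HolderConjugate.ne_zero q p
  set s := q.toReal
  have hrpow {r : ℝ} (hr : 0 ≤ r) : Continuous fun t : ℝ => |t| ^ r :=
    continuous_abs.rpow_const fun _ => .inr hr
  have hint {G : ℝ → ℝ} (hG : Continuous G) : Integrable (fun x => G (h x)) μ :=
    memLp_one_iff_integrable.1 (memLp_comp_of_memLp_top hh hG 1)
  have hbound : ∀ ε > 0, lpNorm h q μ ^ s - ε * ∫ x, |h x| ^ (s - 1) ∂μ ≤
      D * lpNorm h q μ ^ (s - 1) := fun ε hε => by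
    obtain ⟨G, hG, hGle, hleG⟩ := exists_continuous_le_mul_self hs hε
    calc lpNorm h q μ ^ s - ε * ∫ x, |h x| ^ (s - 1) ∂μ
        = ∫ x, (|h x| ^ s - ε * |h x| ^ (s - 1)) ∂μ := by
          rw [lpNorm_rpow_toReal hq0 hq hh.1, integral_sub (hint (hrpow (by linarith)))
            ((hint (hrpow (sub_nonneg.2 hs))).const_mul ε), integral_const_mul]
      _ ≤ ∫ x, G (h x) * h x ∂μ :=
          integral_mono ((hint (hrpow (by linarith))).sub
            ((hint (hrpow (sub_nonneg.2 hs))).const_mul ε)) (hint (hG.mul continuous_id))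
            fun x => hleG (h x)
      _ ≤ D * lpNorm (fun x => G (h x)) p μ := (le_abs_self _).trans (hD G hG)
      _ ≤ D * lpNorm h q μ ^ (s - 1) := by
          gcongr
          exact (lpNorm_mono_real (memLp_comp_of_memLp_top hh (hrpow (sub_nonneg.2 hs)) p)
            fun x => hGle (h x)).trans (lpNorm_abs_rpow_le hq hh.1)
  refine le_of_tendsto (x := 𝓝[>] 0) ?_ (eventually_mem_nhdsWithin.mono hbound)
  refine tendsto_nhdsWithin_of_tendsto_nhds (Continuous.tendsto' (by fun_prop) _ _ (by simp))

lemma ae_abs_le_of_forall_abs_integral_comp_mul_le (hh : MemLp h ∞ μ) {c : ℝ} (hc : D < c)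
    (hD0 : 0 ≤ D)
    (hD : ∀ G : ℝ → ℝ, Continuous G →
      |∫ x, G (h x) * h x ∂μ| ≤ D * lpNorm (fun x => G (h x)) 1 μ) :
    ∀ᵐ x ∂μ, |h x| ≤ c := by
  -- The test function `G` only sees the part of `h` above the level `c`.
  set G : ℝ → ℝ := fun t => max 0 (|t| - c) * t
  have hG : Continuous G := by fun_prop
  have hint {F : ℝ → ℝ} (hF : Continuous F) : MemLp (fun x => F (h x)) 1 μ :=
    memLp_comp_of_memLp_top hh hF 1
  have hpoint (t : ℝ) : c * |G t| ≤ G t * t := by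
    simp only [G, abs_mul, abs_of_nonneg (le_max_left 0 (|t| - c))]
    rw [mul_assoc _ t, ← abs_mul_abs_self t]
    rcases le_total |t| c with ht | ht
    · simp [max_eq_left (sub_nonpos.2 ht)]
    · nlinarith [mul_nonneg (le_max_left 0 (|t| - c)) (abs_nonneg t)]
  have hnorm : c * lpNorm (fun x => G (h x)) 1 μ ≤ D * lpNorm (fun x => G (h x)) 1 μ :=
    calc c * lpNorm (fun x => G (h x)) 1 μ = ∫ x, c * |G (h x)| ∂μ := by
          rw [lpNorm_one_eq_integral_norm (hint hG).1, integral_const_mul]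
          rfl
      _ ≤ ∫ x, G (h x) * h x ∂μ :=
          integral_mono (memLp_one_iff_integrable.1 (hint (hG.abs.const_mul c)))
            (memLp_one_iff_integrable.1 (hint (hG.mul continuous_id))) fun x => hpoint (h x)
      _ ≤ _ := (le_abs_self _).trans (hD G hG)
  have hzero : lpNorm (fun x => G (h x)) 1 μ = 0 :=
    le_antisymm (by nlinarith) lpNorm_nonneg
  filter_upwards [(lpNorm_eq_zero (hint hG) one_ne_zero).1 hzero] with x hx
  rcases mul_eq_zero.1 hx with hx | hx
  · exact sub_nonpos.1 (max_eq_left_iff.1 hx)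
  · simpa [hx] using hD0.trans hc.le

lemma lpNorm_le_of_forall_abs_integral_comp_mul_le [NeZero μ] [q.HolderConjugate p]
    (hh : MemLp h ∞ μ)
    (hD : ∀ G : ℝ → ℝ, Continuous G →
      |∫ x, G (h x) * h x ∂μ| ≤ D * lpNorm (fun x => G (h x)) p μ) :
    lpNorm h q μ ≤ D := by
  have hD0 : 0 ≤ D := by
    have hp0 : p ≠ 0 := ENNReal.HolderConjugate.ne_zero p q
    have hone := hD (fun _ => 1) continuous_const
    refine nonneg_of_mul_nonneg_left ((abs_nonneg _).trans hone) ?_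
    refine lt_of_le_of_ne lpNorm_nonneg fun h0 => ?_
    obtain ⟨_, hx⟩ := ((lpNorm_eq_zero (memLp_const 1) hp0).1 h0.symm).exists
    exact one_ne_zero hx
  rcases eq_or_ne q ∞ with rfl | hq
  · obtain rfl : p = 1 := ENNReal.HolderConjugate.unique ∞ p 1
    exact le_of_forall_gt_imp_ge_of_dense fun c hc => lpNorm_top_le_of_ae_abs_le
      (hD0.trans hc.le) hh.1 (ae_abs_le_of_forall_abs_integral_comp_mul_le hh hc hD0 hD)
  · rcases (lpNorm_nonneg (f := h) (p := q) (μ := μ)).eq_or_lt with h0 | hpos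
    · exact h0 ▸ hD0
    · have hle := lpNorm_rpow_le_of_forall_abs_integral_comp_mul_le hq hh hD0 hD
      rw [← sub_add_cancel q.toReal 1, Real.rpow_add_one hpos.ne', mul_comm,
        add_sub_cancel_right] at hle
      exact le_of_mul_le_mul_right hle (Real.rpow_pos_of_pos hpos _)

end Duality

section StrictMono

variable [IsProbabilityMeasure μ] {E : Type*} [NormedAddCommGroup E] {f : α → E} {q r : ℝ≥0∞}

lemma lpNorm_lt_lpNorm_of_ne_top (hf : MemLp f r μ) (hq0 : q ≠ 0) (hqr : q < r) (hr : r ≠ ∞)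
    (hne : ∀ c : ℝ, ¬ (fun x => ‖f x‖) =ᵐ[μ] fun _ => c) : lpNorm f q μ < lpNorm f r μ := by
  have hqt : q ≠ ∞ := (hqr.trans_le le_top).ne
  have hr0 : r ≠ 0 := (hq0.bot_lt.trans hqr).ne'
  have hfq : MemLp f q μ := hf.mono_exponent hqr.le
  have hQ : 0 < q.toReal := ENNReal.toReal_pos hq0 hqt
  have hR : 0 < r.toReal := ENNReal.toReal_pos hr0 hr
  have hQR : q.toReal < r.toReal := (ENNReal.toReal_lt_toReal hqt hr).2 hqr
  have hpow (x : α) : (‖f x‖ ^ q.toReal) ^ (r.toReal / q.toReal) = ‖f x‖ ^ r.toReal := by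
    rw [← Real.rpow_mul (norm_nonneg _), mul_div_cancel₀ _ hQ.ne']
  have hJensen := (strictConvexOn_rpow ((one_lt_div hQ).2 hQR)).ae_eq_const_or_map_average_lt
    (μ := μ) (f := fun x => ‖f x‖ ^ q.toReal)
    (Real.continuous_rpow_const (by positivity)).continuousOn isClosed_Ici
    (.of_forall fun x => Real.rpow_nonneg (norm_nonneg _) _) (hfq.integrable_norm_rpow hq0 hqt)
    (by simpa only [Function.comp_def, hpow] using hf.integrable_norm_rpow hr0 hr)
  simp only [average_eq_integral, hpow] at hJensen
  rw [lpNorm_eq_integral_norm_rpow_toReal hq0 hqt hf.1,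
    lpNorm_eq_integral_norm_rpow_toReal hr0 hr hf.1]
  have hI : 0 ≤ ∫ x, ‖f x‖ ^ q.toReal ∂μ := integral_nonneg fun _ => by positivity
  rcases hJensen with hconst | hlt
  · refine absurd ?_ (hne ((∫ x, ‖f x‖ ^ q.toReal ∂μ) ^ q.toReal⁻¹))
    filter_upwards [hconst] with x hx
    rw [← Real.rpow_rpow_inv (norm_nonneg (f x)) hQ.ne']
    exact congrArg (· ^ q.toReal⁻¹) hx
  · have := Real.rpow_lt_rpow (Real.rpow_nonneg hI _) hlt (inv_pos.2 hR)
    rwa [← Real.rpow_mul hI, div_mul_eq_mul_div, mul_inv_cancel₀ hR.ne', one_div] at this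

lemma lpNorm_lt_lpNorm (hf : MemLp f r μ) (hq0 : q ≠ 0) (hqr : q < r)
    (hne : ∀ c : ℝ, ¬ (fun x => ‖f x‖) =ᵐ[μ] fun _ => c) : lpNorm f q μ < lpNorm f r μ := by
  rcases eq_or_ne r ∞ with rfl | hr
  · have hlt := lpNorm_lt_lpNorm_of_ne_top (hf.mono_exponent le_top) hq0
      (ENNReal.lt_add_right hqr.ne one_ne_zero)
      (ENNReal.add_ne_top.2 ⟨hqr.ne, ENNReal.one_ne_top⟩) hne
    refine hlt.trans_le ?_
    rw [← toReal_eLpNorm hf.1, ← toReal_eLpNorm hf.1]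
    exact ENNReal.toReal_mono hf.2.ne (eLpNorm_le_eLpNorm_of_exponent_le le_top hf.1)
  · exact lpNorm_lt_lpNorm_of_ne_top hf hq0 hqr hr hne

end StrictMono

end Lp

/-! ### The smallest constant for a fixed polynomial -/

section Interval

variable {a b : ℝ} {g : ℝ → ℝ}

lemma memLp_Icc_of_continuous (hg : Continuous g) (p : ℝ≥0∞) (a b : ℝ) :
    MemLp g p (volume.restrict (Icc a b)) := by
  obtain ⟨M, hM⟩ := isCompact_Icc.exists_bound_of_continuousOn (s := Icc a b) hg.continuousOn
  exact MemLp.of_bound hg.aestronglyMeasurable M (ae_restrict_of_forall_mem measurableSet_Icc hM)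

lemma lpNormOn_eq_lpNorm {p : ℝ≥0∞} (hg : AEStronglyMeasurable g (volume.restrict (Icc a b))) :
    lpNormOn p a b g = lpNorm g p (volume.restrict (Icc a b)) :=
  toReal_eLpNorm hg

lemma integral_eq_integral_Icc (hab : a ≤ b) :
    ∫ x in a..b, g x = ∫ x in Icc a b, g x := by
  rw [intervalIntegral.integral_of_le hab, integral_Icc_eq_integral_Ioc]

lemma map_volume_mul_add {c : ℝ} (hc : c ≠ 0) (d : ℝ) :
    Measure.map (fun x => c * x + d) volume = ENNReal.ofReal |c⁻¹| • volume := by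
  change Measure.map ((· + d) ∘ (c * ·)) volume = _
  rw [← Measure.map_map (measurable_add_const d) (measurable_const_mul c),
    Real.map_volume_mul_left hc, Measure.map_smul, map_add_right_eq_self]

lemma map_restrict_Icc_mul_add {c : ℝ} (hc : 0 < c) (d a b : ℝ) :
    Measure.map (fun x => c * x + d) (volume.restrict (Icc a b)) =
      ENNReal.ofReal c⁻¹ • volume.restrict (Icc (c * a + d) (c * b + d)) := by
  have hpre : (fun x => c * x + d) ⁻¹' Icc (c * a + d) (c * b + d) = Icc a b := by
    ext x
    simp [hc]
  rw [← hpre, ← Measure.restrict_map (by fun_prop) measurableSet_Icc,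
    map_volume_mul_add hc.ne', Measure.restrict_smul, abs_of_pos (inv_pos.2 hc)]

lemma lpNormOn_comp_mul_add {c : ℝ} (hc : 0 < c) (d : ℝ) (q : ℝ≥0∞) (hg : Measurable g) :
    lpNormOn q a b (fun x => g (c * x + d)) =
      c⁻¹ ^ q.toReal⁻¹ * lpNormOn q (c * a + d) (c * b + d) g := by
  have hmap := eLpNorm_map_measure (p := q) (μ := volume.restrict (Icc a b))
    (f := fun x => c * x + d) hg.aestronglyMeasurable (by fun_prop)
  rw [map_restrict_Icc_mul_add hc, eLpNorm_smul_measure_of_ne_zero (by simpa using hc)] at hmap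
  rw [lpNormOn, ← Function.comp_def g, ← hmap, smul_eq_mul, ENNReal.toReal_mul, lpNormOn,
    ← ENNReal.toReal_rpow, ENNReal.toReal_ofReal (inv_nonneg.2 hc.le), one_div,
    ENNReal.toReal_inv]

end Interval

section ErrorConst

variable {n : ℕ} {p : ℝ≥0∞} {φ : ℝ[X]}

/-- The norm of the polynomial `φ` in `L^q([-1,1])`, the quantity to be minimised over the monic
polynomials of degree `n`. -/
def refNorm (q : ℝ≥0∞) (φ : ℝ[X]) : ℝ := lpNormOn q (-1) 1 fun x => φ.eval x

lemma refNorm_eq_lpNorm (q : ℝ≥0∞) (φ : ℝ[X]) :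
    refNorm q φ = lpNorm (fun x => φ.eval x) q (volume.restrict (Icc (-1) 1)) :=
  lpNormOn_eq_lpNorm φ.continuous.aestronglyMeasurable

lemma refNorm_smul (q : ℝ≥0∞) (c : ℝ) (φ : ℝ[X]) : refNorm q (c • φ) = |c| * refNorm q φ := by
  simp only [refNorm_eq_lpNorm, eval_smul]
  exact lpNorm_const_smul c (fun x => φ.eval x) _

lemma invConj_eq_inv_toReal (p : ℝ≥0∞) : invConj p = (ENNReal.conjExponent p).toReal⁻¹ :=
  ENNReal.toReal_inv _

lemma continuous_transplant (n : ℕ) (φ : ℝ[X]) (a b : ℝ) : Continuous (transplant n φ a b) := by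
  unfold transplant
  fun_prop

lemma transplant_neg_one_one (n : ℕ) (φ : ℝ[X]) (x : ℝ) : transplant n φ (-1) 1 x = φ.eval x := by
  unfold transplant
  norm_num

lemma lpNormOn_transplant (n : ℕ) (φ : ℝ[X]) (q : ℝ≥0∞) {a b : ℝ} (hab : a < b) :
    lpNormOn q a b (transplant n φ a b) =
      ((b - a) / 2) ^ (n + q.toReal⁻¹) * refNorm q φ := by
  have hba : 0 < b - a := sub_pos.2 hab
  have haff : transplant n φ a b = fun x => ((b - a) / 2) ^ n •
      φ.eval (2 / (b - a) * x + -(a + b) / (b - a)) := by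
    ext x
    rw [transplant, smul_eq_mul]
    congr 2
    ring
  have hscale : lpNormOn q a b (transplant n φ a b) = ((b - a) / 2) ^ n *
      lpNormOn q a b (fun x => φ.eval (2 / (b - a) * x + -(a + b) / (b - a))) := by
    rw [haff, lpNormOn, ← Pi.smul_def, eLpNorm_const_smul, ENNReal.toReal_mul, toReal_enorm,
      Real.norm_of_nonneg (by positivity)]
    rfl
  have hleft : 2 / (b - a) * a + -(a + b) / (b - a) = -1 := by field_simp; ring
  have hright : 2 / (b - a) * b + -(a + b) / (b - a) = 1 := by field_simp; ring
  rw [hscale, lpNormOn_comp_mul_add (by positivity) _ q φ.continuous.measurable, hleft, hright,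
    inv_div, refNorm, Real.rpow_add (by positivity), Real.rpow_natCast, mul_assoc]

lemma abs_errorTerm (n : ℕ) (φ : ℝ[X]) (a b : ℝ) (f : ℝ → ℝ) :
    |errorTerm n φ a b f| =
      |∫ x in a..b, derivOn n a b f x * transplant n φ a b x| / (n.factorial : ℝ) := by
  rw [errorTerm, abs_mul, abs_div, abs_pow, abs_neg, abs_one, one_pow, Nat.abs_cast,
    div_mul_eq_mul_div, one_mul]

lemma isErrorConstant_refNorm (hp : 1 ≤ p) (n : ℕ) (φ : ℝ[X]) :
    IsErrorConstant n p φ ((2 : ℝ) ^ (-(n : ℝ) - invConj p) *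
      refNorm (ENNReal.conjExponent p) φ / (n.factorial : ℝ)) := by
  intro a b hab f hf
  have hpq := ENNReal.HolderConjugate.conjExponent hp
  have hba : 0 < b - a := sub_pos.2 hab
  have htr := memLp_Icc_of_continuous (continuous_transplant n φ a b)
    (ENNReal.conjExponent p) a b
  have hHolder := abs_integral_mul_le_lpNorm_mul_lpNorm hf.memLp htr
  rw [← lpNormOn_eq_lpNorm hf.memLp.1, ← lpNormOn_eq_lpNorm htr.1, lpNormOn_transplant n φ _ hab,
    ← invConj_eq_inv_toReal, ← integral_eq_integral_Icc hab.le,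
    Real.div_rpow hba.le two_pos.le] at hHolder
  rw [abs_errorTerm, ← neg_add', Real.rpow_neg two_pos.le]
  calc _ ≤ _ := div_le_div_of_nonneg_right hHolder (Nat.cast_nonneg _)
    _ = _ := by ring

lemma exists_contDiff_iteratedDeriv_eq {E : Type*} [NormedAddCommGroup E] [NormedSpace ℝ E]
    [CompleteSpace E] {g : ℝ → E} (hg : Continuous g) (n : ℕ) :
    ∃ f : ℝ → E, ContDiff ℝ n f ∧ iteratedDeriv n f = g := by
  induction n with
  | zero => exact ⟨g, contDiff_zero.2 hg, iteratedDeriv_zero⟩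
  | succ n ih =>
    obtain ⟨f, hf, hfg⟩ := ih
    have hprim (x : ℝ) : HasDerivAt (fun x => ∫ t in (0 : ℝ)..x, f t) (f x) x :=
      hf.continuous.integral_hasStrictDerivAt 0 x |>.hasDerivAt
    have hderiv : deriv (fun x => ∫ t in (0 : ℝ)..x, f t) = f := funext fun x => (hprim x).deriv
    refine ⟨fun x => ∫ t in (0 : ℝ)..x, f t, ?_, ?_⟩
    · rw [Nat.cast_succ, contDiff_succ_iff_deriv, hderiv]
      exact ⟨fun x => (hprim x).differentiableAt, by simp, hf⟩
    · rw [iteratedDeriv_succ', hderiv, hfg]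

lemma exists_isAdmissible_derivOn_eq {g : ℝ → ℝ} (hg : Continuous g) (hn : 1 ≤ n)
    (p : ℝ≥0∞) {a b : ℝ} (hab : a < b) :
    ∃ f : ℝ → ℝ, IsAdmissible n p a b f ∧ EqOn (derivOn n a b f) g (Icc a b) := by
  obtain ⟨f, hf, hfg⟩ := exists_contDiff_iteratedDeriv_eq hg n
  have huniq := uniqueDiffOn_Icc hab
  have hderivOn : EqOn (derivOn n a b f) g (Icc a b) := fun x hx => by
    rw [derivOn, iteratedDerivWithin_eq_iteratedDeriv huniq hf.contDiffAt hx, hfg]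
  have hf' : ContDiff ℝ (n - 1 : ℕ) f := hf.of_le (by exact_mod_cast Nat.sub_le n 1)
  refine ⟨f, ⟨hf'.contDiffOn, ?_, ?_⟩, hderivOn⟩
  · have hsmooth : ContDiff ℝ 1 (iteratedDeriv (n - 1) f) := by
      rw [iteratedDeriv_eq_iterate]
      exact (hf.of_le (by exact_mod_cast (Nat.add_sub_of_le hn).le)).iterate_deriv' 1 (n - 1)
    refine ContDiffOn.absolutelyContinuousOnInterval ?_
    rw [uIcc_of_le hab.le]
    exact hsmooth.contDiffOn.congr fun x hx =>
      iteratedDerivWithin_eq_iteratedDeriv huniq hf'.contDiffAt hx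
  · refine (memLp_congr_ae ?_).2 (memLp_Icc_of_continuous hg p a b)
    exact ae_restrict_of_forall_mem measurableSet_Icc hderivOn

lemma IsErrorConstant.abs_integral_mul_le (hn : 1 ≤ n) {C : ℝ} (hC : IsErrorConstant n p φ C)
    {g : ℝ → ℝ} (hg : Continuous g) :
    |∫ x in Icc (-1) 1, g x * φ.eval x| ≤
      C * (n.factorial : ℝ) * (2 : ℝ) ^ ((n : ℝ) + invConj p) *
        lpNorm g p (volume.restrict (Icc (-1) 1)) := by
  have h11 : (-1 : ℝ) < 1 := by norm_num
  obtain ⟨f, hf, hfg⟩ := exists_isAdmissible_derivOn_eq hg hn p h11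
  have hae : derivOn n (-1) 1 f =ᵐ[volume.restrict (Icc (-1) 1)] g :=
    ae_restrict_of_forall_mem measurableSet_Icc hfg
  have hnorm : lpNormOn p (-1) 1 (derivOn n (-1) 1 f) =
      lpNorm g p (volume.restrict (Icc (-1) 1)) := by
    rw [lpNormOn, eLpNorm_congr_ae hae, toReal_eLpNorm hg.aestronglyMeasurable]
  have hint : ∫ x in (-1)..1, derivOn n (-1) 1 f x * transplant n φ (-1) 1 x =
      ∫ x in Icc (-1) 1, g x * φ.eval x := by
    rw [integral_eq_integral_Icc h11.le]
    refine setIntegral_congr_fun measurableSet_Icc fun x hx => ?_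
    simp only [hfg hx, transplant_neg_one_one]
  have hbound := hC (-1) 1 h11 f hf
  rw [abs_errorTerm, hint, hnorm, div_le_iff₀ (by positivity), sub_neg_eq_add,
    one_add_one_eq_two] at hbound
  linarith

instance : NeZero (volume.restrict (Icc (-1 : ℝ) 1)) :=
  ⟨Measure.restrict_eq_zero.not.2 (by simp)⟩

lemma isLeast_isErrorConstant (hn : 1 ≤ n) (hp : 1 ≤ p) (φ : ℝ[X]) :
    IsLeast {C : ℝ | IsErrorConstant n p φ C} ((2 : ℝ) ^ (-(n : ℝ) - invConj p) *
      refNorm (ENNReal.conjExponent p) φ / (n.factorial : ℝ)) := by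
  refine ⟨isErrorConstant_refNorm hp n φ, fun C hC => ?_⟩
  have hpq := (ENNReal.HolderConjugate.conjExponent hp).symm
  have hdual := lpNorm_le_of_forall_abs_integral_comp_mul_le (q := ENNReal.conjExponent p) (p := p)
    (memLp_Icc_of_continuous φ.continuous ∞ (-1) 1)
    fun G hG => hC.abs_integral_mul_le hn (hG.comp φ.continuous)
  rw [← refNorm_eq_lpNorm] at hdual
  rw [div_le_iff₀ (by positivity), ← neg_add', Real.rpow_neg two_pos.le,
    inv_mul_le_iff₀ (by positivity), mul_comm]
  exact hdual

lemma errorConst_eq (hn : 1 ≤ n) (hp : 1 ≤ p) (φ : ℝ[X]) :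
    errorConst n p φ = (2 : ℝ) ^ (-(n : ℝ) - invConj p) *
      refNorm (ENNReal.conjExponent p) φ / (n.factorial : ℝ) :=
  (isLeast_isErrorConstant hn hp φ).csInf_eq

end ErrorConst

section StrictAnti

variable {n : ℕ} {φ : ℝ[X]}

lemma exists_mem_abs_eval_ne {S : Set ℝ} (hS : S.Infinite) (hφ : φ.natDegree ≠ 0)
    (c : ℝ) : ∃ x ∈ S, |φ.eval x| ≠ c := by
  by_contra! h
  have hsq : φ ^ 2 - C (c ^ 2) = 0 :=
    eq_zero_of_infinite_isRoot _ (hS.mono fun x hx => by simp [← h x hx])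
  have hdeg := congrArg natDegree (sub_eq_zero.1 hsq)
  rw [natDegree_pow, natDegree_C] at hdeg
  omega

lemma two_rpow_neg_mul_refNorm {q : ℝ≥0∞} (φ : ℝ[X]) :
    (2 : ℝ) ^ (-q.toReal⁻¹) * refNorm q φ =
      lpNorm (fun x => φ.eval x) q ((2⁻¹ : ℝ≥0∞) • volume.restrict (Icc (-1) 1)) := by
  rw [refNorm, lpNormOn, ← toReal_eLpNorm φ.continuous.aestronglyMeasurable,
    eLpNorm_smul_measure_of_ne_zero (by simp), smul_eq_mul, ENNReal.toReal_mul,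
    ← ENNReal.toReal_rpow, one_div, ENNReal.toReal_inv, ENNReal.toReal_inv, ENNReal.toReal_ofNat,
    Real.inv_rpow two_pos.le, Real.rpow_neg two_pos.le]

lemma two_rpow_neg_mul_refNorm_lt (hφ : φ.natDegree ≠ 0) {q r : ℝ≥0∞} (hq : q ≠ 0)
    (hqr : q < r) :
    (2 : ℝ) ^ (-q.toReal⁻¹) * refNorm q φ < (2 : ℝ) ^ (-r.toReal⁻¹) * refNorm r φ := by
  have huniform : IsProbabilityMeasure ((2⁻¹ : ℝ≥0∞) • volume.restrict (Icc (-1 : ℝ) 1)) := by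
    constructor
    norm_num [Real.volume_Icc, ENNReal.inv_mul_cancel]
  rw [two_rpow_neg_mul_refNorm, two_rpow_neg_mul_refNorm]
  refine lpNorm_lt_lpNorm ((memLp_Icc_of_continuous φ.continuous r (-1) 1).smul_measure (by simp))
    hq hqr fun c hc => ?_
  obtain ⟨x, hx, hne⟩ := exists_mem_abs_eval_ne
    (Icc_infinite (by norm_num : (-1 : ℝ) < 1)) hφ c
  have hae : (fun x => ‖φ.eval x‖) =ᵐ[volume.restrict (Icc (-1 : ℝ) 1)] fun _ => c :=
    Measure.ae_ennreal_smul_measure_iff (by simp) |>.1 hc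
  exact hne (Measure.eqOn_Icc_of_ae_eq volume (by norm_num) hae φ.continuous.norm.continuousOn
    continuousOn_const hx)

lemma one_le_conjExponent (p : ℝ≥0∞) : 1 ≤ ENNReal.conjExponent p :=
  le_self_add

lemma conjExponent_lt_conjExponent {p r : ℝ≥0∞} (hp : 1 ≤ p) (hpr : p < r) :
    ENNReal.conjExponent r < ENNReal.conjExponent p :=
  ENNReal.add_lt_add_left ENNReal.one_ne_top
    (ENNReal.inv_lt_inv.2 (lt_tsub_iff_right.2 (by rwa [tsub_add_cancel_of_le hp])))

lemma strictAntiOn_errorConst (hn : 1 ≤ n) (hφ : φ ∈ monicPolys n) :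
    StrictAntiOn (fun p : ℝ≥0∞ => errorConst n p φ) (Ici 1) := by
  intro p (hp : 1 ≤ p) r hr hpr
  have hlt := two_rpow_neg_mul_refNorm_lt (φ := φ) (by rw [hφ.2]; omega)
    (one_pos.trans_le (one_le_conjExponent r)).ne' (conjExponent_lt_conjExponent hp hpr)
  rw [← invConj_eq_inv_toReal, ← invConj_eq_inv_toReal] at hlt
  simp only [errorConst_eq hn hp, errorConst_eq hn hr, sub_eq_add_neg, Real.rpow_add two_pos,
    mul_assoc]
  gcongr

end StrictAnti

/-! ### Monic polynomials of least norm -/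

section Monic

variable {n : ℕ} {φ ψ : ℝ[X]}

lemma C_inv_leadingCoeff_mul_mem_monicPolys (hφ : φ ≠ 0) :
    C φ.leadingCoeff⁻¹ * φ ∈ monicPolys φ.natDegree :=
  ⟨monic_C_mul_of_mul_leadingCoeff_eq_one (inv_mul_cancel₀ (leadingCoeff_ne_zero.2 hφ)),
    natDegree_C_mul (inv_ne_zero (leadingCoeff_ne_zero.2 hφ))⟩

lemma add_mem_monicPolys (hφ : φ ∈ monicPolys n) {P : ℝ[X]} (hP : P ∈ degreeLT ℝ n) :
    φ + P ∈ monicPolys n := by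
  have hdeg : P.degree < φ.degree := by
    rw [degree_eq_natDegree hφ.1.ne_zero, hφ.2]
    exact mem_degreeLT.1 hP
  exact ⟨hφ.1.add_of_left hdeg, (natDegree_add_eq_left_of_degree_lt hdeg).trans hφ.2⟩

lemma sub_mem_degreeLT (hφ : φ ∈ monicPolys n) (hψ : ψ ∈ monicPolys n) :
    ψ - φ ∈ degreeLT ℝ n := by
  have hdegφ := degree_eq_natDegree hφ.1.ne_zero
  have hdegψ := degree_eq_natDegree hψ.1.ne_zero
  rw [hφ.2] at hdegφ
  rw [hψ.2] at hdegψ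
  rw [mem_degreeLT, ← hdegψ]
  exact degree_sub_lt_left (hdegψ.trans hdegφ.symm) hψ.1.ne_zero
    (hψ.1.leadingCoeff.trans hφ.1.leadingCoeff.symm)

lemma map_eq_of_mem_monicPolys {M : Type*} [AddCommGroup M] [Module ℝ M] {L : ℝ[X] →ₗ[ℝ] M}
    (hL : degreeLT ℝ n ≤ LinearMap.ker L) (hφ : φ ∈ monicPolys n) (hψ : ψ ∈ monicPolys n) :
    L ψ = L φ :=
  sub_eq_zero.1 (by rw [← map_sub]; exact hL (sub_mem_degreeLT hφ hψ))

end Monic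

section Existence

lemma exists_mem_submodule_forall_norm_add_le {E : Type*} [NormedAddCommGroup E]
    [NormedSpace ℝ E] (S : Submodule ℝ E) [FiniteDimensional ℝ S] (x : E) :
    ∃ s ∈ S, ∀ t ∈ S, ‖x + s‖ ≤ ‖x + t‖ := by
  have : ProperSpace S := FiniteDimensional.proper ℝ S
  have hcoercive : Filter.Tendsto (fun s : S => ‖x + s‖) (Filter.cocompact S) Filter.atTop := by
    refine Filter.tendsto_atTop_mono (fun s => ?_) (Filter.tendsto_atTop_add_const_right _ (-‖x‖)
      (tendsto_norm_cocompact_atTop (E := S)))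
    simpa [← sub_eq_add_neg, add_comm] using norm_sub_le_norm_add (s : E) x
  obtain ⟨s, hs⟩ := Continuous.exists_forall_le (by fun_prop) hcoercive
  exact ⟨s, s.2, fun t ht => hs ⟨t, ht⟩⟩

/-- The inclusion of the polynomials in `L^q([-1,1])`. -/
def polynomialToLp (q : ℝ≥0∞) : ℝ[X] →ₗ[ℝ] Lp ℝ q (volume.restrict (Icc (-1 : ℝ) 1)) where
  toFun P := (memLp_Icc_of_continuous P.continuous q (-1) 1).toLp (fun x => P.eval x)
  map_add' P Q := by
    rw [← MemLp.toLp_add]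
    congr 1
    ext x
    exact eval_add
  map_smul' c P := by
    rw [RingHom.id_apply, ← MemLp.toLp_const_smul]
    congr 1
    ext x
    exact eval_smul c P x

lemma norm_polynomialToLp (q : ℝ≥0∞) (P : ℝ[X]) : ‖polynomialToLp q P‖ = refNorm q P :=
  Lp.norm_toLp _ (memLp_Icc_of_continuous P.continuous q (-1) 1)

lemma exists_isMinOn_refNorm (n : ℕ) {q : ℝ≥0∞} (hq : 1 ≤ q) :
    ∃ φ ∈ monicPolys n, IsMinOn (refNorm q) (monicPolys n) φ := by
  have : Fact (1 ≤ q) := ⟨hq⟩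
  have : Module.Finite ℝ (degreeLT ℝ n) := .equiv (degreeLTEquiv ℝ n).symm
  have hX : (X ^ n : ℝ[X]) ∈ monicPolys n := ⟨monic_X_pow n, natDegree_X_pow n⟩
  obtain ⟨_, ⟨P, hP, rfl⟩, hmin⟩ := exists_mem_submodule_forall_norm_add_le
    ((degreeLT ℝ n).map (polynomialToLp q)) (polynomialToLp q (X ^ n))
  refine ⟨X ^ n + P, add_mem_monicPolys hX hP, isMinOn_iff.2 fun ψ hψ => ?_⟩
  have hle := hmin _ (Submodule.mem_map_of_mem (sub_mem_degreeLT hX hψ))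
  rwa [← map_add, ← map_add, add_sub_cancel, norm_polynomialToLp, norm_polynomialToLp] at hle

end Existence

section ChebyshevFirstKind

lemma abs_eval_le_refNorm_top (P : ℝ[X]) {x : ℝ} (hx : x ∈ Icc (-1) 1) :
    |P.eval x| ≤ refNorm ∞ P := by
  have hmax : (fun y => max |P.eval y| (refNorm ∞ P)) =ᵐ[volume.restrict (Icc (-1) 1)]
      fun _ => refNorm ∞ P := by
    rw [refNorm_eq_lpNorm]
    filter_upwards [ae_le_lpNorm_exponent_top (memLp_Icc_of_continuous P.continuous ∞ (-1) 1)]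
      with y hy using max_eq_right hy
  exact max_eq_right_iff.1
    (Measure.eqOn_Icc_of_ae_eq volume (by norm_num) hmax (by fun_prop) (by fun_prop) hx)

lemma inv_two_pow_le_refNorm_top {n : ℕ} {ψ : ℝ[X]} (hψ : ψ ∈ monicPolys n) :
    ((2 : ℝ) ^ (n - 1))⁻¹ ≤ refNorm ∞ ψ := by
  have hpos : 0 < refNorm ∞ ψ := by
    by_contra! hle
    exact hψ.1.ne_zero (eq_zero_of_infinite_isRoot _ ((Icc_infinite (neg_lt_self one_pos)).mono
      fun x hx => abs_nonpos_iff.1 ((abs_eval_le_refNorm_top ψ hx).trans hle)))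
  have hdeg : (C (refNorm ∞ ψ)⁻¹ * ψ).degree ≤ n := by
    rw [degree_C_mul (inv_ne_zero hpos.ne')]
    exact natDegree_le_iff_degree_le.1 hψ.2.le
  have hcoeff := Chebyshev.coeff_le_of_forall_abs_le_one hdeg fun x hx => by
    rw [eval_mul, eval_C, abs_mul, abs_of_pos (inv_pos.2 hpos), inv_mul_le_one₀ hpos]
    exact abs_eval_le_refNorm_top ψ hx
  rw [coeff_C_mul, ← hψ.2, hψ.1.coeff_natDegree, mul_one, hψ.2] at hcoeff
  exact inv_le_of_inv_le₀ hpos hcoeff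

lemma isLeast_refNorm_top (n : ℕ) :
    IsLeast (refNorm ∞ '' monicPolys n) ((2 : ℝ) ^ (n - 1))⁻¹ := by
  have hlead : (Chebyshev.T ℝ n).leadingCoeff = 2 ^ (n - 1) := by simp
  have hne : Chebyshev.T ℝ n ≠ 0 := leadingCoeff_ne_zero.1 (by rw [hlead]; positivity)
  have hmem := C_inv_leadingCoeff_mul_mem_monicPolys hne
  rw [Chebyshev.natDegree_T, Int.natAbs_natCast, hlead] at hmem
  refine ⟨⟨_, hmem, le_antisymm ?_ (inv_two_pow_le_refNorm_top hmem)⟩, ?_⟩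
  · rw [refNorm_eq_lpNorm]
    refine lpNorm_top_le_of_ae_abs_le (by positivity) (Polynomial.continuous _).aestronglyMeasurable
      (ae_restrict_of_forall_mem measurableSet_Icc fun x hx => ?_)
    rw [eval_mul, eval_C, abs_mul, abs_of_pos (by positivity)]
    exact mul_le_of_le_one_right (by positivity)
      (Chebyshev.abs_eval_T_real_le_one n (abs_le.2 hx))
  · rintro _ ⟨ψ, hψ, rfl⟩
    exact inv_two_pow_le_refNorm_top hψ

end ChebyshevFirstKind

section ChebyshevSecondKind

/-- The definite integral of polynomials, as a linear map. -/
def polyIntegral (a b : ℝ) : ℝ[X] →ₗ[ℝ] ℝ where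
  toFun P := ∫ x in a..b, P.eval x
  map_add' P Q := by
    simp only [eval_add]
    exact intervalIntegral.integral_add (P.continuous.intervalIntegrable _ _)
      (Q.continuous.intervalIntegrable _ _)
  map_smul' c P := by
    simp only [eval_smul, smul_eq_mul, RingHom.id_apply, intervalIntegral.integral_const_mul]

lemma polyIntegral_derivative (a b : ℝ) (P : ℝ[X]) :
    polyIntegral a b (derivative P) = P.eval b - P.eval a :=
  intervalIntegral.integral_eq_sub_of_hasDerivAt (fun x _ => P.hasDerivAt x)
    ((derivative P).continuous.intervalIntegrable _ _)

/-- The integral over `[-1,1]` against the step function whose sign alternates at the extremal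
points `cos (j π / N)` of the Chebyshev polynomial `T_N`; for `N = n + 1` this is the sign of
`U_n`, because these points other than `±1` are the zeros of `U_n`. -/
def alternatingIntegral (N : ℕ) : ℝ[X] →ₗ[ℝ] ℝ :=
  ∑ j ∈ Finset.range N,
    (-1 : ℝ) ^ j • polyIntegral (Chebyshev.node N (j + 1)) (Chebyshev.node N j)

lemma alternatingIntegral_apply (N : ℕ) (P : ℝ[X]) :
    alternatingIntegral N P = ∑ j ∈ Finset.range N, (-1) ^ j *
      polyIntegral (Chebyshev.node N (j + 1)) (Chebyshev.node N j) P := by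
  simp only [alternatingIntegral, LinearMap.sum_apply, LinearMap.smul_apply, smul_eq_mul]

lemma node_succ_le {N j : ℕ} (hj : j < N) : Chebyshev.node N (j + 1) ≤ Chebyshev.node N j :=
  (Chebyshev.node_lt hj j.lt_succ_self).le

lemma refNorm_one_eq_sum_nodes {N : ℕ} (hN : N ≠ 0) (P : ℝ[X]) :
    refNorm 1 P = ∑ j ∈ Finset.range N,
      ∫ x in Chebyshev.node N (j + 1)..Chebyshev.node N j, |P.eval x| := by
  have hadjacent := intervalIntegral.sum_integral_adjacent_intervals (μ := volume)
    (a := Chebyshev.node N) (n := N) fun k _ => P.continuous.abs.intervalIntegrable _ _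
  rw [Chebyshev.node_eq_one, Chebyshev.node_eq_neg_one hN] at hadjacent
  rw [refNorm_eq_lpNorm, lpNorm_one_eq_integral_norm P.continuous.aestronglyMeasurable,
    ← integral_eq_integral_Icc (neg_le_self zero_le_one), intervalIntegral.integral_symm]
  simp only [Real.norm_eq_abs]
  rw [← hadjacent, ← Finset.sum_neg_distrib]
  exact Finset.sum_congr rfl fun j _ => (intervalIntegral.integral_symm _ _).symm

lemma alternatingIntegral_le_refNorm_one {N : ℕ} (hN : N ≠ 0) (P : ℝ[X]) :
    alternatingIntegral N P ≤ refNorm 1 P := by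
  rw [refNorm_one_eq_sum_nodes hN, alternatingIntegral_apply]
  refine Finset.sum_le_sum fun j hj => (le_abs_self _).trans ?_
  rw [abs_mul, abs_neg_one_pow, one_mul]
  exact intervalIntegral.abs_integral_le_integral_abs (node_succ_le (Finset.mem_range.1 hj))

lemma neg_one_pow_mul_eval_U_cos_nonneg {n j : ℕ} {θ : ℝ} (hθ : θ ∈ Ioo 0 Real.pi)
    (hlow : j * Real.pi ≤ (n + 1) * θ) (hup : (n + 1) * θ ≤ (j + 1) * Real.pi) :
    0 ≤ (-1) ^ j * (Chebyshev.U ℝ n).eval (Real.cos θ) := by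
  have hsin : 0 ≤ Real.sin ((n + 1) * θ - j * Real.pi) :=
    Real.sin_nonneg_of_nonneg_of_le_pi (by linarith) (by linarith)
  have hU := Chebyshev.U_real_cos θ n
  rw [Int.cast_natCast] at hU
  rw [Real.sin_sub_nat_mul_pi, ← hU, ← mul_assoc] at hsin
  exact nonneg_of_mul_nonneg_left hsin (Real.sin_pos_of_mem_Ioo hθ)

lemma neg_one_pow_mul_eval_U_nonneg {n j : ℕ} (hj : j < n + 1) {x : ℝ}
    (hx : x ∈ Ioo (Chebyshev.node (n + 1) (j + 1)) (Chebyshev.node (n + 1) j)) :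
    0 ≤ (-1) ^ j * (Chebyshev.U ℝ n).eval x := by
  have harccos (i : ℕ) (hi : i ≤ n + 1) :
      (n + 1) * Real.arccos (Chebyshev.node (n + 1) i) = i * Real.pi := by
    have hle : (i : ℝ) * Real.pi / (n + 1 : ℕ) ≤ Real.pi := by
      rw [div_le_iff₀ (by positivity), mul_comm]
      gcongr
    rw [Chebyshev.node, Real.arccos_cos (by positivity) hle]
    push_cast
    field_simp
  have hx₁ : -1 < x := Chebyshev.node_mem_Icc.1.trans_lt hx.1
  have hx₂ : x < 1 := hx.2.trans_le Chebyshev.node_mem_Icc.2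
  rw [← Real.cos_arccos hx₁.le hx₂.le]
  refine neg_one_pow_mul_eval_U_cos_nonneg
    ⟨Real.arccos_pos.2 hx₂, Real.arccos_lt_pi.2 hx₁⟩ ?_ ?_
  · rw [← harccos j hj.le]
    gcongr
    exact hx.2.le
  · rw [← Nat.cast_add_one j, ← harccos (j + 1) hj]
    gcongr
    exact hx.1.le

lemma refNorm_one_U (n : ℕ) :
    refNorm 1 (Chebyshev.U ℝ n) = alternatingIntegral (n + 1) (Chebyshev.U ℝ n) := by
  rw [refNorm_one_eq_sum_nodes n.succ_ne_zero, alternatingIntegral_apply]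
  refine Finset.sum_congr rfl fun j hj => ?_
  have hj := Finset.mem_range.1 hj
  rw [polyIntegral, LinearMap.coe_mk, AddHom.coe_mk, ← intervalIntegral.integral_const_mul]
  refine intervalIntegral.integral_congr_Ioo_of_le (node_succ_le hj) fun x hx => ?_
  rw [← abs_of_nonneg (neg_one_pow_mul_eval_U_nonneg hj hx), abs_mul, abs_neg_one_pow, one_mul]

lemma polyIntegral_U (k : ℕ) (a b : ℝ) :
    polyIntegral a b (Chebyshev.U ℝ k) =
      ((Chebyshev.T ℝ (k + 1 : ℕ)).eval b - (Chebyshev.T ℝ (k + 1 : ℕ)).eval a) / (k + 1) := by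
  have hderiv : derivative (Chebyshev.T ℝ (k + 1 : ℕ)) =
      ((k : ℝ) + 1) • Chebyshev.U ℝ k := by
    rw [Chebyshev.T_derivative_eq_U, Nat.cast_add_one, add_sub_cancel_right, smul_eq_C_mul]
    simp
  rw [← polyIntegral_derivative, hderiv, map_smul, smul_eq_mul, mul_div_cancel_left₀]
  positivity

lemma alternatingIntegral_U_self (n : ℕ) :
    alternatingIntegral (n + 1) (Chebyshev.U ℝ n) = 2 := by
  have hterm (j : ℕ) (hj : j ∈ Finset.range (n + 1)) : (-1 : ℝ) ^ j *
      polyIntegral (Chebyshev.node (n + 1) (j + 1)) (Chebyshev.node (n + 1) j)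
        (Chebyshev.U ℝ n) = 2 / (n + 1) := by
    have hj := Finset.mem_range.1 hj
    rw [polyIntegral_U, Chebyshev.eval_T_real_node (Finset.mem_Iic.2 hj.le),
      Chebyshev.eval_T_real_node (Finset.mem_Iic.2 hj), ← mul_div_assoc, mul_sub, pow_succ,
      ← mul_assoc, ← mul_pow]
    norm_num
  rw [alternatingIntegral_apply, Finset.sum_congr rfl hterm, Finset.sum_const, Finset.card_range,
    nsmul_eq_mul, Nat.cast_add_one]
  field_simp

lemma sum_neg_one_pow_mul_cos_sub_cos_eq_zero {α : ℝ} {N : ℕ} (hα : Real.cos (α / 2) ≠ 0)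
    (hN : Real.sin (N * α) = 0) :
    ∑ j ∈ Finset.range N, (-1) ^ j * (Real.cos (j * α) - Real.cos ((j + 1 : ℕ) * α)) = 0 := by
  have htelescope (j : ℕ) :
      Real.cos (α / 2) * ((-1) ^ j * (Real.cos (j * α) - Real.cos ((j + 1 : ℕ) * α))) =
        -Real.sin (α / 2) * (-1) ^ (j + 1) * Real.sin ((j + 1 : ℕ) * α) -
          -Real.sin (α / 2) * (-1) ^ j * Real.sin (j * α) := by
    have hmid₁ : j * α = (j * α + α / 2) - α / 2 := by ring
    have hmid₂ : (j + 1 : ℕ) * α = (j * α + α / 2) + α / 2 := by push_cast; ring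
    generalize (j * α + α / 2 : ℝ) = β at hmid₁ hmid₂
    rw [hmid₂, hmid₁, Real.cos_sub, Real.cos_add, Real.sin_sub, Real.sin_add, pow_succ]
    ring
  refine (mul_eq_zero.1 (?_ : Real.cos (α / 2) * _ = 0)).resolve_left hα
  rw [Finset.mul_sum, Finset.sum_congr rfl fun j _ => htelescope j,
    Finset.sum_range_sub fun j : ℕ => -Real.sin (α / 2) * (-1) ^ j * Real.sin (j * α), hN]
  simp

lemma alternatingIntegral_U_of_lt {k n : ℕ} (hk : k < n) :
    alternatingIntegral (n + 1) (Chebyshev.U ℝ k) = 0 := by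
  obtain ⟨α, hα⟩ : ∃ α, α = (k + 1) * Real.pi / (n + 1) := ⟨_, rfl⟩
  have hα₀ : 0 ≤ α := hα ▸ by positivity
  have hαπ : α < Real.pi := by
    rw [hα, div_lt_iff₀ (by positivity), mul_comm]
    gcongr
  have hcos : Real.cos (α / 2) ≠ 0 :=
    (Real.cos_pos_of_mem_Ioo ⟨by linarith [Real.pi_pos], by linarith⟩).ne'
  have hsin : Real.sin ((n + 1 : ℕ) * α) = 0 := by
    rw [← Real.sin_nat_mul_pi (k + 1), hα]
    congr 1
    push_cast
    field_simp
  have hT (j : ℕ) : (Chebyshev.T ℝ (k + 1 : ℕ)).eval (Chebyshev.node (n + 1) j) =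
      Real.cos (j * α) := by
    rw [Chebyshev.node, Chebyshev.T_real_cos, hα]
    congr 1
    push_cast
    ring
  simp only [alternatingIntegral_apply, polyIntegral_U, hT, ← mul_div_assoc]
  rw [← Finset.sum_div, sum_neg_one_pow_mul_cos_sub_cos_eq_zero hcos hsin, zero_div]

/-- The Chebyshev polynomials of the second kind, one for each degree. -/
def chebyshevUSequence : Polynomial.Sequence ℝ where
  elems' k := Chebyshev.U ℝ k
  degree_eq' := Chebyshev.degree_U_natCast ℝ

lemma degreeLT_le_ker_alternatingIntegral (n : ℕ) :
    degreeLT ℝ n ≤ LinearMap.ker (alternatingIntegral (n + 1)) := by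
  rw [← chebyshevUSequence.span_degreeLT fun i _ =>
    (leadingCoeff_ne_zero.2 (chebyshevUSequence.ne_zero i)).isUnit, Submodule.span_le]
  rintro _ ⟨k, hk, rfl⟩
  exact alternatingIntegral_U_of_lt hk

lemma isLeast_refNorm_one (n : ℕ) : IsLeast (refNorm 1 '' monicPolys n) (2 / 2 ^ n) := by
  have hlead : (Chebyshev.U ℝ n).leadingCoeff = 2 ^ n := Chebyshev.leadingCoeff_U_natCast ℝ n
  have hmem := C_inv_leadingCoeff_mul_mem_monicPolys (φ := Chebyshev.U ℝ n)
    (leadingCoeff_ne_zero.1 (by rw [hlead]; positivity))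
  rw [Chebyshev.natDegree_U_natCast, hlead, ← smul_eq_C_mul] at hmem
  have hvalue : alternatingIntegral (n + 1) (((2 : ℝ) ^ n)⁻¹ • Chebyshev.U ℝ n) = 2 / 2 ^ n := by
    rw [map_smul, alternatingIntegral_U_self, smul_eq_mul, inv_mul_eq_div]
  refine ⟨⟨_, hmem, ?_⟩, ?_⟩
  · rw [refNorm_smul, refNorm_one_U, ← hvalue, map_smul, smul_eq_mul, abs_of_pos (by positivity)]
  · rintro _ ⟨ψ, hψ, rfl⟩
    rw [← hvalue, ← map_eq_of_mem_monicPolys (degreeLT_le_ker_alternatingIntegral n) hmem hψ]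
    exact alternatingIntegral_le_refNorm_one n.succ_ne_zero ψ

end ChebyshevSecondKind

section Legendre

variable {n : ℕ} {a b : ℝ} {P φ ψ : ℝ[X]}

lemma polyIntegral_derivative_mul (ha : P.eval a = 0) (hb : P.eval b = 0) (Q : ℝ[X]) :
    polyIntegral a b (derivative P * Q) = -polyIntegral a b (P * derivative Q) := by
  have h := polyIntegral_derivative a b (P * Q)
  rw [derivative_mul, map_add, eval_mul, eval_mul, ha, hb, zero_mul, zero_mul, sub_zero] at h
  exact eq_neg_of_add_eq_zero_left h

lemma polyIntegral_iterate_derivative_mul (ha : ∀ k < n, (derivative^[k] P).eval a = 0)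
    (hb : ∀ k < n, (derivative^[k] P).eval b = 0) (Q : ℝ[X]) :
    polyIntegral a b (derivative^[n] P * Q) =
      (-1) ^ n * polyIntegral a b (P * derivative^[n] Q) := by
  induction n generalizing Q with
  | zero => simp
  | succ n ih =>
    rw [Function.iterate_succ_apply',
      polyIntegral_derivative_mul (ha n n.lt_succ_self) (hb n n.lt_succ_self),
      ih (fun k hk => ha k (hk.trans n.lt_succ_self)) (fun k hk => hb k (hk.trans n.lt_succ_self)),
      ← Function.iterate_succ_apply, pow_succ]
    ring

lemma polyIntegral_X_sq_sub_one_pow_succ (n : ℕ) :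
    (2 * n + 3) * polyIntegral (-1) 1 ((X ^ 2 - 1) ^ (n + 1)) =
      -((2 * n + 2) * polyIntegral (-1) 1 ((X ^ 2 - 1) ^ n)) := by
  have hderiv : derivative (X * (X ^ 2 - 1 : ℝ[X]) ^ (n + 1)) =
      (2 * n + 3 : ℝ) • (X ^ 2 - 1) ^ (n + 1) + (2 * n + 2 : ℝ) • (X ^ 2 - 1) ^ n := by
    simp only [derivative_mul, derivative_X, derivative_pow, derivative_sub, derivative_one,
      map_add, map_mul, map_natCast, map_ofNat, Nat.cast_add, Nat.cast_one, smul_eq_C_mul,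
      Nat.add_sub_cancel, map_one]
    ring
  have h := polyIntegral_derivative (-1) 1 (X * (X ^ 2 - 1 : ℝ[X]) ^ (n + 1))
  rw [hderiv, map_add, map_smul, map_smul, smul_eq_mul, smul_eq_mul] at h
  exact eq_neg_of_add_eq_zero_left (h.trans (by simp))

lemma polyIntegral_X_sq_sub_one_pow (n : ℕ) :
    polyIntegral (-1) 1 ((X ^ 2 - 1) ^ n) =
      (-1) ^ n * (2 ^ (2 * n + 1) * (n.factorial : ℝ) ^ 2 / (2 * n + 1).factorial) := by
  induction n with
  | zero =>
    have h := polyIntegral_derivative (-1) 1 X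
    rw [derivative_X] at h
    norm_num [h]
  | succ n ih =>
    have hrec := polyIntegral_X_sq_sub_one_pow_succ n
    rw [ih, mul_comm, ← eq_div_iff (by positivity)] at hrec
    rw [hrec, mul_add_one 2 n, Nat.factorial_succ (2 * n + 2), Nat.factorial_succ (2 * n + 1),
      Nat.factorial_succ n]
    push_cast
    field_simp
    ring

lemma C_mul_iterate_derivative_mem_monicPolys {k : ℕ} (hφ : φ ∈ monicPolys (n + k)) :
    C ((n.factorial : ℝ) / (n + k).factorial) * derivative^[k] φ ∈ monicPolys n := by
  have hcoeff : (C ((n.factorial : ℝ) / (n + k).factorial) * derivative^[k] φ).coeff n = 1 := by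
    have hlead : φ.coeff (n + k) = 1 := hφ.2 ▸ hφ.1.coeff_natDegree
    have hfact := Nat.factorial_mul_descFactorial (Nat.le_add_left k n)
    rw [Nat.add_sub_cancel] at hfact
    rw [coeff_C_mul, coeff_iterate_derivative, hlead, nsmul_one, div_mul_eq_mul_div,
      ← Nat.cast_mul, hfact, div_self (by positivity)]
  have hdeg := (natDegree_C_mul_le ((n.factorial : ℝ) / (n + k).factorial) _).trans
    (natDegree_iterate_derivative φ k)
  rw [hφ.2, Nat.add_sub_cancel] at hdeg
  exact ⟨monic_of_natDegree_le_of_coeff_eq_one n hdeg hcoeff,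
    natDegree_eq_of_le_of_coeff_ne_zero hdeg (hcoeff ▸ one_ne_zero)⟩

lemma iterate_derivative_of_mem_monicPolys (hφ : φ ∈ monicPolys n) :
    derivative^[n] φ = C (n.factorial : ℝ) := by
  have hmem := C_mul_iterate_derivative_mem_monicPolys (n := 0) ((zero_add n).symm ▸ hφ)
  have hone := hmem.1.natDegree_eq_zero.1 hmem.2
  rw [zero_add, Nat.factorial_zero, Nat.cast_one, one_div] at hone
  rw [← mul_one (C (n.factorial : ℝ)), ← hone, ← mul_assoc, ← C_mul,
    mul_inv_cancel₀ (by positivity), C_1, one_mul]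

lemma X_sq_sub_one_pow_mem_monicPolys (n : ℕ) : (X ^ 2 - 1 : ℝ[X]) ^ n ∈ monicPolys (n + n) := by
  have hmonic : (X ^ 2 - 1 : ℝ[X]).Monic := monic_X_pow_sub_C 1 two_ne_zero
  have hdeg : (X ^ 2 - 1 : ℝ[X]).natDegree = 2 := natDegree_X_pow_sub_C (n := 2) (r := (1 : ℝ))
  exact ⟨hmonic.pow n, by rw [natDegree_pow, hdeg, mul_two]⟩

lemma eval_iterate_derivative_X_sq_sub_one_pow {k : ℕ} (hk : k < n) {t : ℝ} (ht : t ^ 2 = 1) :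
    (derivative^[k] ((X ^ 2 - 1 : ℝ[X]) ^ n)).eval t = 0 := by
  have hroot : X - C t ∣ (X ^ 2 - 1 : ℝ[X]) := dvd_iff_isRoot.2 (by simp [IsRoot, ht])
  refine isRoot_iterate_derivative_of_lt_rootMultiplicity (hk.trans_le ?_)
  rw [le_rootMultiplicity_iff (X_sq_sub_one_pow_mem_monicPolys n).1.ne_zero]
  exact pow_dvd_pow_of_dvd hroot n

/-- The monic Legendre polynomial of degree `n`, by Rodrigues' formula. -/
def monicLegendre (n : ℕ) : ℝ[X] :=
  C ((n.factorial : ℝ) / (n + n).factorial) * derivative^[n] ((X ^ 2 - 1) ^ n)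

/-- The square of the norm of the monic Legendre polynomial of degree `n` in `L^2([-1,1])`. -/
def legendreNormSq (n : ℕ) : ℝ :=
  2 * (2 ^ n * (n.factorial : ℝ) ^ 2 / (2 * n).factorial) ^ 2 / (2 * n + 1)

lemma monicLegendre_mem_monicPolys (n : ℕ) : monicLegendre n ∈ monicPolys n :=
  C_mul_iterate_derivative_mem_monicPolys (X_sq_sub_one_pow_mem_monicPolys n)

lemma polyIntegral_monicLegendre_mul (hψ : ψ ∈ monicPolys n) :
    polyIntegral (-1) 1 (monicLegendre n * ψ) = legendreNormSq n := by
  have hparts := polyIntegral_iterate_derivative_mul (a := -1) (b := 1)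
    (fun k (hk : k < n) => eval_iterate_derivative_X_sq_sub_one_pow hk (by norm_num))
    (fun k hk => eval_iterate_derivative_X_sq_sub_one_pow hk (by norm_num)) ψ
  rw [iterate_derivative_of_mem_monicPolys hψ, mul_comm (_ ^ n) (C _), ← smul_eq_C_mul, map_smul,
    polyIntegral_X_sq_sub_one_pow, smul_eq_mul, mul_left_comm (n.factorial : ℝ), ← mul_assoc,
    ← mul_pow, neg_mul_neg, one_mul, one_pow, one_mul] at hparts
  rw [monicLegendre, mul_assoc, ← smul_eq_C_mul, map_smul, hparts, legendreNormSq, ← two_mul,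
    Nat.factorial_succ, smul_eq_mul]
  push_cast
  field_simp
  ring

lemma polyIntegral_mul_le_refNorm_two_mul (P Q : ℝ[X]) :
    polyIntegral (-1) 1 (P * Q) ≤ refNorm 2 P * refNorm 2 Q := by
  have hHolder := abs_integral_mul_le_lpNorm_mul_lpNorm
    (memLp_Icc_of_continuous P.continuous 2 (-1) 1) (memLp_Icc_of_continuous Q.continuous 2 (-1) 1)
  rw [← refNorm_eq_lpNorm, ← refNorm_eq_lpNorm,
    ← integral_eq_integral_Icc (neg_le_self zero_le_one)] at hHolder
  simp only [← eval_mul] at hHolder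
  exact (le_abs_self _).trans hHolder

lemma refNorm_two_eq_sqrt (P : ℝ[X]) : refNorm 2 P = √(polyIntegral (-1) 1 (P * P)) := by
  rw [refNorm_eq_lpNorm, lpNorm_eq_integral_norm_rpow_toReal two_ne_zero ENNReal.ofNat_ne_top
    P.continuous.aestronglyMeasurable, Real.sqrt_eq_rpow, polyIntegral, LinearMap.coe_mk,
    AddHom.coe_mk, integral_eq_integral_Icc (neg_le_self zero_le_one)]
  simp [← sq]

lemma isLeast_refNorm_two (n : ℕ) : IsLeast (refNorm 2 '' monicPolys n) √(legendreNormSq n) := by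
  have hmem := monicLegendre_mem_monicPolys n
  have hnorm : refNorm 2 (monicLegendre n) = √(legendreNormSq n) := by
    rw [refNorm_two_eq_sqrt, polyIntegral_monicLegendre_mul hmem]
  have hpos : 0 < legendreNormSq n := by unfold legendreNormSq; positivity
  refine ⟨⟨_, hmem, hnorm⟩, ?_⟩
  rintro _ ⟨ψ, hψ, rfl⟩
  have hle := polyIntegral_mul_le_refNorm_two_mul (monicLegendre n) ψ
  rw [polyIntegral_monicLegendre_mul hψ, hnorm] at hle
  refine le_of_mul_le_mul_left ?_ (Real.sqrt_pos.2 hpos)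
  rwa [Real.mul_self_sqrt hpos.le]

end Legendre

/-! ### The optimal constant -/

section OptimalConst

variable {n : ℕ} {p : ℝ≥0∞} {φ : ℝ[X]}

lemma isMinOn_errorConst (hn : 1 ≤ n) (hp : 1 ≤ p)
    (hφ : IsMinOn (refNorm (ENNReal.conjExponent p)) (monicPolys n) φ) :
    IsMinOn (errorConst n p) (monicPolys n) φ := by
  refine isMinOn_iff.2 fun ψ hψ => ?_
  rw [errorConst_eq hn hp, errorConst_eq hn hp]
  have hle := isMinOn_iff.1 hφ ψ hψ
  gcongr

lemma optimalConst_eq_errorConst (hφ : φ ∈ monicPolys n)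
    (hmin : IsMinOn (errorConst n p) (monicPolys n) φ) :
    optimalConst n p = errorConst n p φ :=
  IsLeast.csInf_eq ⟨mem_image_of_mem _ hφ, forall_mem_image.2 (isMinOn_iff.1 hmin)⟩

lemma exists_isMinOn_errorConst (hn : 1 ≤ n) (hp : 1 ≤ p) :
    ∃ φ ∈ monicPolys n, IsMinOn (errorConst n p) (monicPolys n) φ := by
  obtain ⟨φ, hφ, hmin⟩ := exists_isMinOn_refNorm n (one_le_conjExponent p)
  exact ⟨φ, hφ, isMinOn_errorConst hn hp hmin⟩

lemma optimalConst_eq_of_isLeast (hn : 1 ≤ n) (hp : 1 ≤ p) {q : ℝ≥0∞} [hpq : p.HolderConjugate q]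
    {r : ℝ} (hr : IsLeast (refNorm q '' monicPolys n) r) :
    optimalConst n p = (2 : ℝ) ^ (-(n : ℝ) - q.toReal⁻¹) * r / (n.factorial : ℝ) := by
  obtain ⟨⟨φ, hφ, rfl⟩, hmin⟩ := hr
  obtain rfl := hpq.conjExponent_eq
  have hmin := isMinOn_errorConst hn hp (isMinOn_iff.2 (forall_mem_image.1 hmin))
  rw [optimalConst_eq_errorConst hφ hmin, errorConst_eq hn hp, invConj_eq_inv_toReal]

lemma strictAntiOn_optimalConst (hn : 1 ≤ n) :
    StrictAntiOn (fun p : ℝ≥0∞ => optimalConst n p) (Ici 1) := by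
  intro p hp r hr hpr
  obtain ⟨φ, hφ, hφmin⟩ := exists_isMinOn_errorConst hn hp
  obtain ⟨χ, hχ, hχmin⟩ := exists_isMinOn_errorConst hn hr
  calc optimalConst n r = errorConst n r χ := optimalConst_eq_errorConst hχ hχmin
    _ ≤ errorConst n r φ := isMinOn_iff.1 hχmin φ hφ
    _ < errorConst n p φ := strictAntiOn_errorConst hn hφ hp hr hpr
    _ = optimalConst n p := (optimalConst_eq_errorConst hφ hφmin).symm

lemma optimalConst_one (hn : 1 ≤ n) :
    optimalConst n 1 = (2 : ℝ) ^ (1 - 2 * (n : ℤ)) / (n.factorial : ℝ) := by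
  have hexp : 1 - 2 * (n : ℤ) = -((n + (n - 1) : ℕ) : ℤ) := by omega
  rw [optimalConst_eq_of_isLeast hn le_rfl (isLeast_refNorm_top n), ENNReal.toReal_top, inv_zero,
    sub_zero, Real.rpow_neg two_pos.le, Real.rpow_natCast, ← mul_inv, ← pow_add, hexp, zpow_neg,
    zpow_natCast]

lemma optimalConst_top (hn : 1 ≤ n) :
    optimalConst n ∞ = (2 : ℝ) ^ (-2 * (n : ℤ)) / (n.factorial : ℝ) := by
  have hexp : -2 * (n : ℤ) = -((n + n : ℕ) : ℤ) := by omega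
  rw [optimalConst_eq_of_isLeast hn le_top (isLeast_refNorm_one n), ENNReal.toReal_one, inv_one,
    ← neg_add', ← Nat.cast_add_one, Real.rpow_neg two_pos.le, Real.rpow_natCast, hexp, zpow_neg,
    zpow_natCast, pow_add, pow_succ]
  field_simp
  ring

lemma optimalConst_two (hn : 1 ≤ n) :
    optimalConst n 2 =
      (n.factorial : ℝ) * (2 * (n : ℝ) + 1) ^ (-(1 / 2) : ℝ) / ((2 * n).factorial : ℝ) := by
  have hnorm : √(legendreNormSq n) =
      √2 * (2 ^ n * (n.factorial : ℝ) ^ 2 / (2 * n).factorial) / √(2 * n + 1) := by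
    rw [legendreNormSq, Real.sqrt_div (by positivity), Real.sqrt_mul two_pos.le,
      Real.sqrt_sq (by positivity)]
  have hpow : (2 : ℝ) ^ (-(n : ℝ) - 1 / 2) = (2 ^ n)⁻¹ * (√2)⁻¹ := by
    rw [← neg_add', Real.rpow_neg two_pos.le, Real.rpow_add two_pos, Real.rpow_natCast,
      ← Real.sqrt_eq_rpow, mul_inv]
  rw [optimalConst_eq_of_isLeast hn one_le_two (isLeast_refNorm_two n), ENNReal.toReal_ofNat,
    ← one_div, hpow, hnorm, Real.rpow_neg (by positivity), ← Real.sqrt_eq_rpow]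
  field_simp

end OptimalConst

end Quadrature

end

theorem mainTheorem7 (n : ℕ) (hn : 1 ≤ n) :
    -- the infima that define the constants are minima, given by the norm of the minimizing `φ`
    (∀ p : ℝ≥0∞, 1 ≤ p →
      (∀ φ ∈ Quadrature.monicPolys n,
        IsLeast {C : ℝ | Quadrature.IsErrorConstant n p φ C} (Quadrature.errorConst n p φ)) ∧
      ∃ φ ∈ Quadrature.monicPolys n,
        (∀ ψ ∈ Quadrature.monicPolys n,
          Quadrature.errorConst n p φ ≤ Quadrature.errorConst n p ψ) ∧
        Quadrature.optimalConst n p = Quadrature.errorConst n p φ ∧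
        Quadrature.optimalConst n p =
          (2 : ℝ) ^ (-(n : ℝ) - Quadrature.invConj p) *
            Quadrature.lpNormOn (ENNReal.conjExponent p) (-1) 1 (fun x => φ.eval x) / (n.factorial : ℝ)) ∧
    -- the explicit values
    Quadrature.optimalConst n 1 = (2 : ℝ) ^ (1 - 2 * (n : ℤ)) / (n.factorial : ℝ) ∧
    Quadrature.optimalConst n 2 =
      (n.factorial : ℝ) * (2 * (n : ℝ) + 1) ^ (-(1 / 2) : ℝ) / ((2 * n).factorial : ℝ) ∧
    Quadrature.optimalConst n ∞ = (2 : ℝ) ^ (-2 * (n : ℤ)) / (n.factorial : ℝ) ∧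
    -- monotonicity in `p ∈ [1, ∞]`, for the optimal constant and for each fixed polynomial
    StrictAntiOn (fun p : ℝ≥0∞ => Quadrature.optimalConst n p) (Ici 1) ∧
    (∀ φ ∈ Quadrature.monicPolys n,
      StrictAntiOn (fun p : ℝ≥0∞ => Quadrature.errorConst n p φ) (Ici 1)) ∧
    (∀ p : ℝ≥0∞, 1 ≤ p → Quadrature.optimalConst n p ≤ Quadrature.optimalConst n 1) ∧
    (∀ p : ℝ≥0∞, 1 ≤ p → ∀ φ ∈ Quadrature.monicPolys n,
      Quadrature.errorConst n p φ ≤ Quadrature.errorConst n 1 φ) := by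
  refine ⟨fun p hp => ⟨fun φ _ => ?_, ?_⟩, Quadrature.optimalConst_one hn,
    Quadrature.optimalConst_two hn, Quadrature.optimalConst_top hn,
    Quadrature.strictAntiOn_optimalConst hn, fun φ hφ => Quadrature.strictAntiOn_errorConst hn hφ,
    fun p hp => (Quadrature.strictAntiOn_optimalConst hn).antitoneOn self_mem_Ici hp hp,
    fun p hp φ hφ => (Quadrature.strictAntiOn_errorConst hn hφ).antitoneOn self_mem_Ici hp hp⟩
  · rw [Quadrature.errorConst_eq hn hp]
    exact Quadrature.isLeast_isErrorConstant hn hp φ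
  · obtain ⟨φ, hφ, hmin⟩ := Quadrature.exists_isMinOn_errorConst hn hp
    have hopt := Quadrature.optimalConst_eq_errorConst hφ hmin
    exact ⟨φ, hφ, isMinOn_iff.1 hmin, hopt, hopt.trans (Quadrature.errorConst_eq hn hp φ)⟩
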